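/- Let $K$ be a field of characteristic different from $2$ and let $p,q\ge 0$. Let $F=F_{p,q}(\mathfrak B_{\rm sup})$ be the free bicommutative superalgebra over $K$ with even free generators $y_1,\dots,y_p$ and odd free generators $z_1,\dots,z_q$, i.e. the free object on $X=\{y_1,\dots,y_p,z_1,\dots,z_q\}$ in the class of (nonassociative) superalgebras satisfying, for homogeneous elements, $a(bc)=(-1)^{\bar a\,\bar b}\,b(ac)$ and $(ab)c=(-1)^{\bar b\,\bar c}\,(ac)b$. Let $[X]$ be the commutative semigroup with zero (without unit) generated by $X$ with relations $z_j^2=0$, and put $x\circ x'=x\otimes x'$, $x\circ(u\otimes v)=xu\otimes v$, $(u\otimes v)\circ x=u\otimes vx$ for $x,x'\in X$ and $u,v\in[X]$. By a monomial we mean a nonzero element of $X\cup[X]\otimes[X]$. The monomial $x\in X$ is identified with the generator $x$ of $F$, and the monomial $u\otimes v$ with the element $$a_1(a_2(\cdots(a_{k-1}((\cdots((a_kb_1)b_2)\cdots)b_l))\cdots))\in F,$$ where $u=a_1\cdots a_k$, $v=b_1\cdots b_l$ and the factors are written in increasing order with respect to $y_1<\dots<y_p<z_1<\dots<z_q$;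 these elements form a basis of the vector space $F$. Let $\preceq$ be a well-ordering of the monomials such that for all monomials $u\prec v$ and all $x\in X$: if $x\circ u\ne0$ and $x\circ v\neq 0$, then $x\circ u\prec x\circ v$; and if $u\circ x\ne 0$ and $v\circ x\ne0$, then $u\circ x\prec v\circ x$. For $0\ne f\in F$ let $\mathrm{lead}(f)$ be the largest monomial that occurs in $f$ with nonzero coefficient. A monomial $m$ divides a monomial $m'$ if $m'$ is obtained from $m$ by finitely many (possibly zero) consecutive multiplications $\circ$, from the left or from the right, by elements of $X$. A subset $G$ of a two-sided ideal $I$ of $F$ is a Gröbner–Shirshov basis of $I$ (with respect to $\preceq$) if for every $0\ne f\in I$ there is a nonzero $g\in G$ such that $\mathrm{lead}(g)$ divides $\mathrm{lead}(f)$. Then, for every two-sided ideal $I$ of $F$: (i) $I$ has a finite Gröbner–Shirshov basis; (ii) if $G$ is any Gröbner–Shirshov basis of $I$, then $I$ is generated by $G$ as a two-sided ideal; (iii) if $G$ is any Gröbner–Shirshov basis of $I$, then the images in $F/I$ of the monomials which are not divisible by $\mathrm{lead}(g)$ for any nonzero $g\in G$ are pairwise distinct and form a basis of the vector space $F/I$.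 -/

import Mathlib

noncomputable section

namespace BicommSuper

/-! ### Two-sided ideals of nonassociative algebras and their quotients -/

/-- A subspace `J` of a (nonassociative, nonunital) algebra `A` is a two-sided ideal if
`AJ ⊆ J` and `JA ⊆ J`. -/
def IsTwoSidedIdeal {K A : Type*} [Field K] [NonUnitalNonAssocRing A] [Module K A]
    (J : Submodule K A) : Prop :=
  ∀ a : A, ∀ x ∈ J, a * x ∈ J ∧ x * a ∈ J

/-- The two-sided ideal generated by a set: the smallest two-sided ideal containing it. -/
def idealSpan (K : Type*) {A : Type*} [Field K] [NonUnitalNonAssocRing A] [Module K A]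
    (S : Set A) : Submodule K A :=
  sInf {J : Submodule K A | IsTwoSidedIdeal J ∧ S ⊆ J}

theorem isTwoSidedIdeal_idealSpan (K : Type*) {A : Type*} [Field K] [NonUnitalNonAssocRing A]
    [Module K A] (S : Set A) : IsTwoSidedIdeal (idealSpan K S) := by
  intro a x hx
  simp only [idealSpan, Submodule.mem_sInf, Set.mem_ofPred_eq] at hx ⊢
  exact ⟨fun J hJ => (hJ.1 a x (hx J hJ)).1, fun J hJ => (hJ.1 a x (hx J hJ)).2⟩

theorem subset_idealSpan (K : Type*) {A : Type*} [Field K] [NonUnitalNonAssocRing A]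
    [Module K A] (S : Set A) : S ⊆ idealSpan K S := by
  intro x hx
  simp only [idealSpan, SetLike.mem_coe, Submodule.mem_sInf, Set.mem_ofPred_eq]
  exact fun J hJ => hJ.2 hx

/-! ### The free bicommutative superalgebra on `p` even and `q` odd generators -/

/-- The free generators: `p` even ones `y₁ < ⋯ < y_p`, followed by `q` odd ones
`z₁ < ⋯ < z_q` (`⊕ₗ` is the lexicographically ordered disjoint union). -/
abbrev Gen (p q : ℕ) : Type := Fin p ⊕ₗ Fin q

/-- The odd generator `z_j`. -/
def oddGen {p q : ℕ} (j : Fin q) : Gen p q := toLex (Sum.inr j)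

/-- The number of odd generators (with multiplicity) in a nonassociative word.
The parity of the word is this number modulo two. -/
def oddDeg {p q : ℕ} : FreeMagma (Gen p q) → ℕ
  | FreeMagma.of x => Sum.elim (fun _ => 0) (fun _ => 1) (ofLex x)
  | FreeMagma.mul a b => oddDeg a + oddDeg b

/-- A nonassociative word as an element of the free nonassociative algebra. -/
def word (K : Type*) [Field K] {p q : ℕ} (w : FreeMagma (Gen p q)) :
    FreeNonUnitalNonAssocAlgebra K (Gen p q) :=
  MonoidAlgebra.ofMagma K (FreeMagma (Gen p q)) w

/-- All instances on nonassociative words of the super-left-commutativity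
`a(bc) = (-1)^{|a||b|} b(ac)` and of the super-right-commutativity
`(ab)c = (-1)^{|b||c|} (ac)b`. As these identities are multilinear and the words span the
homogeneous components of the free algebra, the ideal generated by these elements contains all
instances of the identities on homogeneous elements. -/
def relators (K : Type*) [Field K] (p q : ℕ) :
    Set (FreeNonUnitalNonAssocAlgebra K (Gen p q)) :=
  {f | ∃ a b c : FreeMagma (Gen p q),
    f = word K (a * (b * c)) - (-1 : K) ^ (oddDeg a * oddDeg b) • word K (b * (a * c)) ∨
    f = word K ((a * b) * c) - (-1 : K) ^ (oddDeg b * oddDeg c) • word K ((a * c) * b)}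

/-- The ideal of the free nonassociative algebra by which one divides. -/
def relIdeal (K : Type*) [Field K] (p q : ℕ) :
    Submodule K (FreeNonUnitalNonAssocAlgebra K (Gen p q)) :=
  idealSpan K (relators K p q)

/-- The free bicommutative superalgebra `F_{p,q}(𝔅_sup)` over `K`: the free nonassociative
algebra on the generators modulo the super-identities of bicommutativity. -/
def F (K : Type*) [Field K] (p q : ℕ) : Type _ :=
  FreeNonUnitalNonAssocAlgebra K (Gen p q) ⧸ relIdeal K p q

instance (K : Type*) [Field K] (p q : ℕ) : AddCommGroup (F K p q) :=
  inferInstanceAs (AddCommGroup (_ ⧸ relIdeal K p q))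

instance (K : Type*) [Field K] (p q : ℕ) : Module K (F K p q) :=
  inferInstanceAs (Module K (_ ⧸ relIdeal K p q))

/-- The quotient map from the free nonassociative algebra. -/
def toF (K : Type*) [Field K] (p q : ℕ) :
    FreeNonUnitalNonAssocAlgebra K (Gen p q) →ₗ[K] F K p q :=
  (relIdeal K p q).mkQ

/-- The multiplication of `F K p q` as a bilinear map, induced from that of the free
nonassociative algebra. -/
def mulF (K : Type*) [Field K] (p q : ℕ) : F K p q →ₗ[K] F K p q →ₗ[K] F K p q :=
  (relIdeal K p q).liftQ
    (LinearMap.flip ((relIdeal K p q).liftQ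
      (LinearMap.flip ((LinearMap.mul K (FreeNonUnitalNonAssocAlgebra K (Gen p q))).compr₂
        (toF K p q)))
      (by
        intro x hx
        refine LinearMap.ext fun a => ?_
        exact (Submodule.Quotient.mk_eq_zero _).2
          ((isTwoSidedIdeal_idealSpan K (relators K p q)) a x hx).1)))
    (by
      intro x hx
      refine LinearMap.ext fun b => ?_
      obtain ⟨b, rfl⟩ := Submodule.Quotient.mk_surjective _ b
      exact (Submodule.Quotient.mk_eq_zero _).2
        ((isTwoSidedIdeal_idealSpan K (relators K p q)) b x hx).2)

instance (K : Type*) [Field K] (p q : ℕ) : NonUnitalNonAssocRing (F K p q) :=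
  { (inferInstance : AddCommGroup (F K p q)) with
    mul := fun a b => mulF K p q a b
    left_distrib := fun a b c => map_add (mulF K p q a) b c
    right_distrib := fun a b c => LinearMap.map_add₂ (mulF K p q) a b c
    zero_mul := fun a => LinearMap.map_zero₂ (mulF K p q) a
    mul_zero := fun a => map_zero (mulF K p q a) }

theorem toF_mul {K : Type*} [Field K] {p q : ℕ}
    (a b : FreeNonUnitalNonAssocAlgebra K (Gen p q)) :
    toF K p q (a * b) = toF K p q a * toF K p q b := rfl

/-! ### The monomials of the free bicommutative superalgebra -/

/-- The nonzero elements of the commutative semigroup with zero `[X_{p,q}]`, generated by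
commuting variables `y₁, …, y_p, z₁, …, z_q` subject to `z_j² = 0`: nonempty multisets of
variables in which no odd variable is repeated. -/
def SMon (p q : ℕ) : Type :=
  {u : Multiset (Gen p q) // u ≠ 0 ∧ ∀ j : Fin q, u.count (oddGen j) ≤ 1}

/-- A variable as an element of `[X_{p,q}]`. -/
def SMon.of {p q : ℕ} (x : Gen p q) : SMon p q :=
  ⟨{x}, Multiset.singleton_ne_zero x, fun _ =>
    (Multiset.nodup_iff_count_le_one.1 (Multiset.nodup_singleton x)) _⟩

/-- The nonzero elements of the multiplicative semigroup `X_{p,q} ∪ [X_{p,q}] ⊗ [X_{p,q}]`: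
a generator `x`, or a tensor product `u ⊗ v`. -/
inductive Mon (p q : ℕ) : Type
  | gen (x : Gen p q) : Mon p q
  | tensor (u v : SMon p q) : Mon p q

/-- `LeftMul x m m'` says that `x ∘ m = m' ≠ 0` in the semigroup
`X_{p,q} ∪ [X_{p,q}] ⊗ [X_{p,q}]`, where `x ∘ y = x ⊗ y` for generators `x, y` and
`x ∘ (u ⊗ v) = xu ⊗ v`. -/
inductive LeftMul {p q : ℕ} (x : Gen p q) : Mon p q → Mon p q → Prop
  | gen (y : Gen p q) : LeftMul x (Mon.gen y) (Mon.tensor (SMon.of x) (SMon.of y))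
  | tensor (u u' v : SMon p q) (h : u'.1 = x ::ₘ u.1) :
      LeftMul x (Mon.tensor u v) (Mon.tensor u' v)

/-- `RightMul x m m'` says that `m ∘ x = m' ≠ 0` in the semigroup
`X_{p,q} ∪ [X_{p,q}] ⊗ [X_{p,q}]`, where `y ∘ x = y ⊗ x` for generators `x, y` and
`(u ⊗ v) ∘ x = u ⊗ vx`. -/
inductive RightMul {p q : ℕ} (x : Gen p q) : Mon p q → Mon p q → Prop
  | gen (y : Gen p q) : RightMul x (Mon.gen y) (Mon.tensor (SMon.of y) (SMon.of x))
  | tensor (u v v' : SMon p q) (h : v'.1 = x ::ₘ v.1) :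
      RightMul x (Mon.tensor u v) (Mon.tensor u v')

/-- `m` divides `m'`: the monomial `m'` is obtained from `m` by finitely many (possibly zero)
consecutive multiplications from either side by generators. -/
def Divides {p q : ℕ} : Mon p q → Mon p q → Prop :=
  Relation.ReflTransGen fun m m' => ∃ x : Gen p q, LeftMul x m m' ∨ RightMul x m m'

/-- The nonassociative word `a₁(a₂(⋯(a_{k-1}((⋯((a_k b₁)b₂)⋯)b_l))⋯))`, where
`a₁, …, a_{k-1}` is the list `as`, `a_k` is `a`, and `b₁, …, b_l` is the list `bs`. -/
def bracket {p q : ℕ} (as : List (Gen p q)) (a : Gen p q) (bs : List (Gen p q)) :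
    FreeMagma (Gen p q) :=
  as.foldr (fun x t => FreeMagma.of x * t) (bs.foldl (fun t x => t * FreeMagma.of x)
    (FreeMagma.of a))

/-- The nonassociative word belonging to a monomial: `x` for a generator `x`, and
`a₁(⋯(a_{k-1}((⋯(a_k b₁)⋯)b_l))⋯)` for `u ⊗ v`, where `a₁ ≤ ⋯ ≤ a_k` are the variables of
`u` and `b₁ ≤ ⋯ ≤ b_l` are those of `v`, both in increasing order (even ones first). -/
def Mon.toMagma {p q : ℕ} : Mon p q → FreeMagma (Gen p q)
  | Mon.gen x => FreeMagma.of x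
  | Mon.tensor u v =>
      bracket u.1.sort.dropLast
        (u.1.sort.getLast fun h => u.2.1 (by rw [← Multiset.sort_eq u.1 (· ≤ ·), h]; rfl))
        v.1.sort

/-- The monomials as elements of `F_{p,q}(𝔅_sup)`. -/
def mon (K : Type*) [Field K] {p q : ℕ} (m : Mon p q) : F K p q :=
  toF K p q (word K m.toMagma)

/-! ### Leading monomials and Gröbner–Shirshov bases -/

/-- A (strict) well-ordering of the monomials that is compatible with the multiplication:
if `u ≺ v` and `xu, xv ≠ 0` then `xu ≺ xv`, and if `u ≺ v` and `ux, vx ≠ 0` then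
`ux ≺ vx`, for every generator `x`. -/
structure IsCompatibleWellOrder {p q : ℕ} (r : Mon p q → Mon p q → Prop) : Prop where
  isWellOrder : IsWellOrder (Mon p q) r
  left : ∀ (x : Gen p q) (u v u' v' : Mon p q),
    r u v → LeftMul x u u' → LeftMul x v v' → r u' v'
  right : ∀ (x : Gen p q) (u v u' v' : Mon p q),
    r u v → RightMul x u u' → RightMul x v v' → r u' v'

/-- `m` is the leading monomial of `f` with respect to the strict ordering `r`: `f` is a linear
combination of monomials in which `m` has a nonzero coefficient and every other monomial that
occurs is smaller than `m`. The zero element has no leading monomial. -/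
def IsLead {K : Type*} [Field K] {p q : ℕ} (r : Mon p q → Mon p q → Prop)
    (f : F K p q) (m : Mon p q) : Prop :=
  ∃ c : Mon p q →₀ K, Finsupp.linearCombination K (mon K) c = f ∧ c m ≠ 0 ∧
    ∀ w ∈ c.support, w ≠ m → r w m

/-- `G` is a Gröbner–Shirshov basis of `I`: a subset of `I` such that the leading monomial of
every nonzero element of `I` is divisible by the leading monomial of some element of `G`. -/
def IsGSBasis {K : Type*} [Field K] {p q : ℕ} (r : Mon p q → Mon p q → Prop)
    (I : Submodule K (F K p q)) (G : Set (F K p q)) : Prop :=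
  G ⊆ I ∧ ∀ f ∈ I, f ≠ 0 → ∃ g ∈ G, ∃ m w : Mon p q,
    IsLead r g m ∧ IsLead r f w ∧ Divides m w

/-- The monomials that are not divisible by the leading monomial of any element of `G`. -/
def Normal {K : Type*} [Field K] {p q : ℕ} (r : Mon p q → Mon p q → Prop)
    (G : Set (F K p q)) : Set (Mon p q) :=
  {w | ¬ ∃ g ∈ G, ∃ m : Mon p q, IsLead r g m ∧ Divides m w}

end BicommSuper

end

/-!
The free bicommutative superalgebra `F` has the monomials as a basis, and multiplication by a
generator sends a monomial `m` to `± (x ∘ m)`, or to zero if `x ∘ m = 0`; from this the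
theory of Gröbner–Shirshov bases follows as for commutative polynomials.

*Spanning.* The identities allow one to permute the left factors and the right factors of a
bracketed word up to sign, and left and right multiplications commute on products. So the class
of `a₁(⋯(a_{k-1}((⋯(a_k b₁)⋯)b_l))⋯)` depends, up to sign, only on the multisets of the `aᵢ`
and of the `bᵢ` (`signEq_bracket_of_perm`), and it vanishes as soon as an odd letter is repeated
in one of them, because `2 ≠ 0`. This gives the action of generators on monomials
(`LeftMul.mul_mon`, `RightMul.mon_mul`, `exists_leftMul_of_ne_zero`,
`exists_rightMul_of_ne_zero`) and hence `span_mon`.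

*Independence.* Take the free supercommutative algebra on two copies `x', x''` of every generator
and let it act on itself by creation operators. Put `λ(x) = x'`, `ρ(x) = x''` and
`λ(ab) = ρ(ab) = λ(a)ρ(b)`. Supercommutativity shows that `λ` and `ρ` respect the identities of
bicommutativity (`relIdeal_le_ker_freeOps`), and the image of `u ⊗ v` under `λ` sends the vacuum
vector to `± u'v''`. These are distinct basis vectors (`linearIndependent_mon`).

*Gröbner–Shirshov bases.* As the ordering is compatible with multiplication, the set of leading
monomials of an ideal is closed under multiples (`IsLead.exists_of_divides`). Divisibility
of monomials is a well-quasi-ordering by Dickson's lemma (`wellQuasiOrdered_divides`), whence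
finite bases exist. The other two claims follow by cancelling leading terms, by induction along
the well-ordering.
-/

noncomputable section

namespace BicommSuper

/-! ### Rewriting words up to sign -/

section Rewriting

variable {K : Type*} [Field K] {p q : ℕ}

instance : IsScalarTower K (F K p q) (F K p q) :=
  ⟨fun k a b => LinearMap.map_smul₂ (mulF K p q) k a b⟩

instance : SMulCommClass K (F K p q) (F K p q) :=
  ⟨fun k a b => (map_smul (mulF K p q a) k b).symm⟩

variable (K) in
/-- The class of a nonassociative word in the free bicommutative superalgebra. -/
def wordF (w : FreeMagma (Gen p q)) : F K p q := toF K p q (word K w)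

theorem wordF_mul (a b : FreeMagma (Gen p q)) : wordF K (a * b) = wordF K a * wordF K b := by
  rw [wordF, word, map_mul, toF_mul]; rfl

theorem wordF_left_comm (a b c : FreeMagma (Gen p q)) :
    wordF K (a * (b * c)) = (-1 : K) ^ (oddDeg a * oddDeg b) • wordF K (b * (a * c)) := by
  rw [← sub_eq_zero]
  exact (Submodule.Quotient.mk_eq_zero _).2
    (subset_idealSpan K (relators K p q) ⟨a, b, c, Or.inl rfl⟩)

theorem wordF_right_comm (a b c : FreeMagma (Gen p q)) :
    wordF K ((a * b) * c) = (-1 : K) ^ (oddDeg b * oddDeg c) • wordF K ((a * c) * b) := by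
  rw [← sub_eq_zero]
  exact (Submodule.Quotient.mk_eq_zero _).2
    (subset_idealSpan K (relators K p q) ⟨a, b, c, Or.inr rfl⟩)

variable (K) in
/-- Two nonassociative words whose classes in the free bicommutative superalgebra agree up to
sign. -/
def SignEq (a b : FreeMagma (Gen p q)) : Prop :=
  wordF K a = wordF K b ∨ wordF K a = -wordF K b

namespace SignEq

variable {a b c d : FreeMagma (Gen p q)}

theorem refl (a : FreeMagma (Gen p q)) : SignEq K a a := Or.inl rfl

theorem symm (h : SignEq K a b) : SignEq K b a := by
  rcases h with h | h
  · exact Or.inl h.symm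
  · exact Or.inr (by rw [h, neg_neg])

theorem trans (h : SignEq K a b) (h' : SignEq K b c) : SignEq K a c := by
  rcases h with h | h <;> rcases h' with h' | h' <;> simp [SignEq, h, h']

theorem mul (h : SignEq K a b) (h' : SignEq K c d) : SignEq K (a * c) (b * d) := by
  rcases h with h | h <;> rcases h' with h' | h' <;> simp [SignEq, wordF_mul, h, h']

theorem eq_zero (h : SignEq K a b) (hb : wordF K b = 0) : wordF K a = 0 := by
  rcases h with h | h <;> simp [h, hb]

theorem left_comm (a b c : FreeMagma (Gen p q)) : SignEq K (a * (b * c)) (b * (a * c)) := by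
  unfold SignEq
  rw [wordF_left_comm]
  rcases neg_one_pow_eq_or K (oddDeg a * oddDeg b) with h | h <;> simp [h]

theorem right_comm (a b c : FreeMagma (Gen p q)) : SignEq K ((a * b) * c) ((a * c) * b) := by
  unfold SignEq
  rw [wordF_right_comm]
  rcases neg_one_pow_eq_or K (oddDeg b * oddDeg c) with h | h <;> simp [h]

/-- Left and right multiplications commute up to sign on products. -/
theorem mul_assoc_prod (x a b y : FreeMagma (Gen p q)) :
    SignEq K (x * ((a * b) * y)) ((x * (a * b)) * y) :=
  ((refl x).mul (right_comm a b y)).trans <| (left_comm x (a * y) b).trans <|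
    (right_comm a y (x * b)).trans <| (left_comm a x b).mul (refl y)

end SignEq

/-- The word `a₁(a₂(⋯(a_k t)⋯))`. -/
def lmul (as : List (Gen p q)) (t : FreeMagma (Gen p q)) : FreeMagma (Gen p q) :=
  as.foldr (fun x t => FreeMagma.of x * t) t

/-- The word `(⋯((t b₁)b₂)⋯)b_l`. -/
def rmul (t : FreeMagma (Gen p q)) (bs : List (Gen p q)) : FreeMagma (Gen p q) :=
  bs.foldl (fun t x => t * FreeMagma.of x) t

theorem lmul_cons (x : Gen p q) (as : List (Gen p q)) (t : FreeMagma (Gen p q)) :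
    lmul (x :: as) t = FreeMagma.of x * lmul as t := rfl

theorem rmul_cons (x : Gen p q) (bs : List (Gen p q)) (t : FreeMagma (Gen p q)) :
    rmul t (x :: bs) = rmul (t * FreeMagma.of x) bs := rfl

theorem rmul_concat (x : Gen p q) (bs : List (Gen p q)) (t : FreeMagma (Gen p q)) :
    rmul t (bs ++ [x]) = rmul t bs * FreeMagma.of x := by
  simp [rmul]

theorem lmul_concat (x : Gen p q) (as : List (Gen p q)) (t : FreeMagma (Gen p q)) :
    lmul (as ++ [x]) t = lmul as (FreeMagma.of x * t) := by
  simp [lmul]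

theorem bracket_eq (as : List (Gen p q)) (a : Gen p q) (bs : List (Gen p q)) :
    bracket as a bs = lmul as (rmul (FreeMagma.of a) bs) := rfl

theorem SignEq.lmul {a b : FreeMagma (Gen p q)} (h : SignEq K a b) (as : List (Gen p q)) :
    SignEq K (lmul as a) (lmul as b) := by
  induction as with
  | nil => exact h
  | cons x as ih => exact (SignEq.refl _).mul ih

theorem SignEq.rmul {a b : FreeMagma (Gen p q)} (h : SignEq K a b) (bs : List (Gen p q)) :
    SignEq K (rmul a bs) (rmul b bs) := by
  induction bs generalizing a b with
  | nil => exact h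
  | cons x bs ih => exact ih (h.mul (SignEq.refl _))

theorem signEq_lmul_of_perm {as as' : List (Gen p q)} (h : as.Perm as')
    (t : FreeMagma (Gen p q)) : SignEq K (lmul as t) (lmul as' t) := by
  induction h with
  | nil => exact SignEq.refl _
  | cons x _ ih => exact (SignEq.refl _).mul ih
  | swap x y l => exact SignEq.left_comm _ _ _
  | trans _ _ ih ih' => exact ih.trans ih'

theorem signEq_rmul_of_perm {bs bs' : List (Gen p q)} (h : bs.Perm bs')
    (t : FreeMagma (Gen p q)) : SignEq K (rmul t bs) (rmul t bs') := by
  induction h generalizing t with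
  | nil => exact SignEq.refl _
  | cons x _ ih => exact ih _
  | swap x y l => exact (SignEq.right_comm _ _ _).rmul l
  | trans _ _ ih ih' => exact (ih t).trans (ih' t)

theorem exists_lmul_mul (as : List (Gen p q)) (s t : FreeMagma (Gen p q)) :
    ∃ s' t', lmul as (s * t) = s' * t' := by
  cases as with
  | nil => exact ⟨s, t, rfl⟩
  | cons x as => exact ⟨_, _, rfl⟩

theorem exists_rmul_mul (bs : List (Gen p q)) (s t : FreeMagma (Gen p q)) :
    ∃ s' t', rmul (s * t) bs = s' * t' := by
  induction bs generalizing s t with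
  | nil => exact ⟨s, t, rfl⟩
  | cons x bs ih => exact ih _ _

theorem signEq_of_mul_rmul (x s t : FreeMagma (Gen p q)) (bs : List (Gen p q)) :
    SignEq K (x * rmul (s * t) bs) (rmul (x * (s * t)) bs) := by
  induction bs generalizing s t with
  | nil => exact SignEq.refl _
  | cons y bs ih => exact (ih _ _).trans ((SignEq.mul_assoc_prod _ _ _ _).rmul bs)

theorem signEq_lmul_rmul (as bs : List (Gen p q)) (s t : FreeMagma (Gen p q)) :
    SignEq K (lmul as (rmul (s * t) bs)) (rmul (lmul as (s * t)) bs) := by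
  induction as with
  | nil => exact SignEq.refl _
  | cons x as ih =>
    obtain ⟨s', t', h⟩ := exists_lmul_mul as s t
    refine ((SignEq.refl _).mul ih).trans ?_
    rw [lmul_cons, h]
    exact signEq_of_mul_rmul _ _ _ _

theorem signEq_bracket_cons (as : List (Gen p q)) (a b : Gen p q) (bs : List (Gen p q)) :
    SignEq K (bracket as a (b :: bs)) (rmul (lmul (as ++ [a]) (FreeMagma.of b)) bs) := by
  rw [lmul_concat]
  exact signEq_lmul_rmul as bs _ _

/-- Up to sign, a bracketed word depends only on the two multisets of letters. -/
theorem signEq_bracket_of_perm {as as' bs bs' : List (Gen p q)} {a a' : Gen p q}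
    (ha : (as ++ [a]).Perm (as' ++ [a'])) (hb : bs.Perm bs') (hne : bs ≠ []) :
    SignEq K (bracket as a bs) (bracket as' a' bs') := by
  refine SignEq.trans ?_ ((signEq_rmul_of_perm hb _).lmul as')
  obtain ⟨b, bs, rfl⟩ := List.exists_cons_of_ne_nil hne
  exact (signEq_bracket_cons _ _ _ _).trans <|
    ((signEq_lmul_of_perm ha _).rmul bs).trans (signEq_bracket_cons as' a' b bs).symm

theorem signEq_bracket_mul (as bs : List (Gen p q)) (a x : Gen p q) (hne : bs ≠ []) :
    SignEq K (bracket as a bs * FreeMagma.of x) (bracket as a (bs ++ [x])) := by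
  obtain ⟨b, bs, rfl⟩ := List.exists_cons_of_ne_nil hne
  rw [bracket_eq, bracket_eq, rmul_concat, rmul_cons]
  obtain ⟨s, t, h⟩ := exists_rmul_mul bs (FreeMagma.of a) (FreeMagma.of b)
  rw [h]
  exact (signEq_lmul_rmul as [x] s t).symm

theorem oddDeg_oddGen (j : Fin q) : oddDeg (FreeMagma.of (oddGen (p := p) j)) = 1 := rfl

theorem eq_zero_of_eq_neg {M : Type*} [AddCommGroup M] [Module K M] (hK : (2 : K) ≠ 0) {v : M}
    (h : v = -v) : v = 0 := by
  have : (2 : K) • v = 0 := by rw [two_smul]; nth_rewrite 1 [h]; simp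
  exact (smul_eq_zero.1 this).resolve_left hK

theorem wordF_odd_left_sq (hK : (2 : K) ≠ 0) (j : Fin q) (t : FreeMagma (Gen p q)) :
    wordF K (FreeMagma.of (oddGen j) * (FreeMagma.of (oddGen j) * t)) = 0 := by
  apply eq_zero_of_eq_neg hK
  have := wordF_left_comm (K := K) (FreeMagma.of (oddGen j)) (FreeMagma.of (oddGen j)) t
  simpa [oddDeg_oddGen] using this

theorem wordF_odd_right_sq (hK : (2 : K) ≠ 0) (j : Fin q) (t : FreeMagma (Gen p q)) :
    wordF K (t * FreeMagma.of (oddGen j) * FreeMagma.of (oddGen j)) = 0 := by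
  apply eq_zero_of_eq_neg hK
  have := wordF_right_comm (K := K) t (FreeMagma.of (oddGen j)) (FreeMagma.of (oddGen j))
  simpa [oddDeg_oddGen] using this

theorem wordF_lmul_eq_zero (as : List (Gen p q)) {t : FreeMagma (Gen p q)}
    (h : wordF K t = 0) : wordF K (lmul as t) = 0 := by
  induction as with
  | nil => exact h
  | cons x as ih => rw [lmul_cons, wordF_mul, ih, mul_zero]

theorem wordF_rmul_eq_zero (bs : List (Gen p q)) {t : FreeMagma (Gen p q)}
    (h : wordF K t = 0) : wordF K (rmul t bs) = 0 := by
  induction bs generalizing t with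
  | nil => exact h
  | cons x as ih => exact ih (by rw [wordF_mul, h, zero_mul])

theorem wordF_bracket_odd_left (hK : (2 : K) ≠ 0) (j : Fin q) {as bs : List (Gen p q)}
    {a : Gen p q} (h : oddGen j ∈ as ++ [a]) (hne : bs ≠ []) :
    wordF K (bracket (oddGen j :: as) a bs) = 0 := by
  obtain ⟨b, bs, rfl⟩ := List.exists_cons_of_ne_nil hne
  obtain ⟨l, l', e⟩ := List.append_of_mem h
  have hp : (oddGen j :: as ++ [a]).Perm (oddGen j :: oddGen j :: (l ++ l')) := by
    rw [List.cons_append, e]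
    exact List.perm_middle.cons _
  refine (signEq_bracket_cons _ _ _ _).eq_zero (wordF_rmul_eq_zero _ ?_)
  exact (signEq_lmul_of_perm hp _).eq_zero (wordF_odd_left_sq hK _ _)

theorem wordF_bracket_odd_right (hK : (2 : K) ≠ 0) (j : Fin q) {as bs : List (Gen p q)}
    {a : Gen p q} (h : oddGen j ∈ bs) :
    wordF K (bracket as a (bs ++ [oddGen j])) = 0 := by
  obtain ⟨l, l', rfl⟩ := List.append_of_mem h
  have hp : (l ++ oddGen j :: l' ++ [oddGen j]).Perm (oddGen j :: oddGen j :: (l ++ l')) :=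
    (List.perm_append_singleton _ _).trans (List.perm_middle.cons _)
  refine wordF_lmul_eq_zero _ ((signEq_rmul_of_perm hp _).eq_zero ?_)
  rw [rmul_cons, rmul_cons]
  exact wordF_rmul_eq_zero _ (wordF_odd_right_sq hK _ _)

/-! ### The action of the generators on the monomials -/

theorem mon_eq (m : Mon p q) : mon K m = wordF K m.toMagma := rfl

theorem exists_toMagma_tensor (u v : SMon p q) :
    ∃ (as : List (Gen p q)) (a : Gen p q) (bs : List (Gen p q)), bs ≠ [] ∧
      ((as ++ [a] : List (Gen p q)) : Multiset (Gen p q)) = u.1 ∧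
      (bs : Multiset (Gen p q)) = v.1 ∧ (Mon.tensor u v).toMagma = bracket as a bs := by
  refine ⟨_, _, _, ?_, ?_, ?_, rfl⟩
  · intro h
    exact v.2.1 (by rw [← Multiset.sort_eq v.1 (· ≤ ·), h]; rfl)
  · rw [List.dropLast_append_getLast, Multiset.sort_eq]
  · rw [Multiset.sort_eq]

theorem signEq_toMagma_tensor {u v : SMon p q} {as bs : List (Gen p q)} {a : Gen p q}
    (ha : ((as ++ [a] : List (Gen p q)) : Multiset (Gen p q)) = u.1)
    (hb : (bs : Multiset (Gen p q)) = v.1) :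
    SignEq K (bracket as a bs) (Mon.tensor u v).toMagma := by
  obtain ⟨as', a', bs', hne, ha', hb', h⟩ := exists_toMagma_tensor u v
  rw [h]
  refine signEq_bracket_of_perm (Multiset.coe_eq_coe.1 (ha.trans ha'.symm))
    (Multiset.coe_eq_coe.1 (hb.trans hb'.symm)) ?_
  rintro rfl
  exact v.2.1 hb.symm

theorem toMagma_tensor_of (x y : Gen p q) :
    SignEq K (FreeMagma.of x * FreeMagma.of y)
      (Mon.tensor (SMon.of x) (SMon.of y)).toMagma :=
  signEq_toMagma_tensor (as := []) (bs := [y]) rfl rfl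

theorem LeftMul.mul_mon {x : Gen p q} {m m' : Mon p q} (h : LeftMul x m m') :
    wordF K (FreeMagma.of x) * mon K m = mon K m' ∨
      wordF K (FreeMagma.of x) * mon K m = -mon K m' := by
  rw [mon_eq, mon_eq, ← wordF_mul]
  cases h with
  | gen y => exact toMagma_tensor_of x y
  | tensor u u' v h =>
    obtain ⟨as, a, bs, hne, ha, hb, e⟩ := exists_toMagma_tensor u v
    rw [e]
    refine signEq_toMagma_tensor (as := x :: as) ?_ hb
    rw [h, ← ha]; rfl

theorem RightMul.mon_mul {x : Gen p q} {m m' : Mon p q} (h : RightMul x m m') :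
    mon K m * wordF K (FreeMagma.of x) = mon K m' ∨
      mon K m * wordF K (FreeMagma.of x) = -mon K m' := by
  rw [mon_eq, mon_eq, ← wordF_mul]
  cases h with
  | gen y => exact toMagma_tensor_of y x
  | tensor u v v' h =>
    obtain ⟨as, a, bs, hne, ha, hb, e⟩ := exists_toMagma_tensor u v
    rw [e]
    refine (signEq_bracket_mul as bs a x hne).trans (signEq_toMagma_tensor ha ?_)
    rw [h, ← hb, ← Multiset.coe_add, add_comm]; rfl

/-- A variable multiplied into a nonzero element of `[X]` gives a nonzero element, unless the
variable is odd and occurs already. -/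
theorem SMon.exists_cons (x : Gen p q) (u : SMon p q) :
    (∃ u' : SMon p q, u'.1 = x ::ₘ u.1) ∨ ∃ j, x = oddGen j ∧ x ∈ u.1 := by
  by_cases h : ∃ j, x = oddGen j ∧ x ∈ u.1
  · exact Or.inr h
  · refine Or.inl ⟨⟨x ::ₘ u.1, Multiset.cons_ne_zero, fun j => ?_⟩, rfl⟩
    rw [Multiset.count_cons]
    split_ifs with hj
    · subst hj
      rw [Multiset.count_eq_zero_of_notMem fun hm => h ⟨j, rfl, hm⟩]
    · exact u.2.2 j

theorem exists_leftMul_of_ne_zero (hK : (2 : K) ≠ 0) {x : Gen p q} {m : Mon p q}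
    (h : wordF K (FreeMagma.of x) * mon K m ≠ 0) : ∃ m', LeftMul x m m' := by
  cases m with
  | gen y => exact ⟨_, .gen y⟩
  | tensor u v =>
    rcases SMon.exists_cons x u with ⟨u', hu'⟩ | ⟨j, rfl, hx⟩
    · exact ⟨_, .tensor u u' v hu'⟩
    · refine (h ?_).elim
      obtain ⟨as, a, bs, hne, ha, hb, e⟩ := exists_toMagma_tensor u v
      rw [mon_eq, ← wordF_mul, e]
      exact wordF_bracket_odd_left hK j (Multiset.mem_coe.1 (ha ▸ hx)) hne

theorem exists_rightMul_of_ne_zero (hK : (2 : K) ≠ 0) {x : Gen p q} {m : Mon p q}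
    (h : mon K m * wordF K (FreeMagma.of x) ≠ 0) : ∃ m', RightMul x m m' := by
  cases m with
  | gen y => exact ⟨_, .gen y⟩
  | tensor u v =>
    rcases SMon.exists_cons x v with ⟨v', hv'⟩ | ⟨j, rfl, hx⟩
    · exact ⟨_, .tensor u v v' hv'⟩
    · refine (h ?_).elim
      obtain ⟨as, a, bs, hne, ha, hb, e⟩ := exists_toMagma_tensor u v
      rw [mon_eq, ← wordF_mul, e]
      exact (signEq_bracket_mul _ _ _ _ hne).eq_zero
        (wordF_bracket_odd_right hK j (Multiset.mem_coe.1 (hb ▸ hx)))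

/-! ### The monomials span -/

theorem mul_mem_span_of_mon {S : Submodule K (F K p q)} {c : F K p q}
    (H : ∀ m : Mon p q, c * mon K m ∈ S ∧ mon K m * c ∈ S) :
    ∀ f ∈ Submodule.span K (Set.range (mon K (p := p) (q := q))), c * f ∈ S ∧ f * c ∈ S := by
  intro f hf
  induction hf using Submodule.span_induction with
  | mem f hf => obtain ⟨m, rfl⟩ := hf; exact H m
  | zero => simp
  | add f g _ _ hf hg =>
    rw [mul_add, add_mul]; exact ⟨S.add_mem hf.1 hg.1, S.add_mem hf.2 hg.2⟩
  | smul k f _ hf =>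
    rw [mul_smul_comm, smul_mul_assoc]; exact ⟨S.smul_mem k hf.1, S.smul_mem k hf.2⟩

/-- The span of the monomials is stable under multiplication by words. For a product `ab` this
reduces to its factors, as `(ab)t = ± (at)b` and `t(ab) = ± a(tb)`. -/
theorem wordF_mul_mem_span_mon (hK : (2 : K) ≠ 0) (w : FreeMagma (Gen p q)) :
    ∀ f ∈ Submodule.span K (Set.range (mon K (p := p) (q := q))),
      wordF K w * f ∈ Submodule.span K (Set.range (mon K (p := p) (q := q))) ∧
      f * wordF K w ∈ Submodule.span K (Set.range (mon K (p := p) (q := q))) := by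
  set S := Submodule.span K (Set.range (mon K (p := p) (q := q))) with hS
  have hmon : ∀ m : Mon p q, mon K m ∈ S := fun m => Submodule.subset_span ⟨m, rfl⟩
  induction w using FreeMagma.recOnMul with
  | ih1 x =>
    refine mul_mem_span_of_mon fun m => ⟨?_, ?_⟩
    · by_cases h : wordF K (FreeMagma.of x) * mon K m = 0
      · rw [h]; exact S.zero_mem
      · obtain ⟨m', hm'⟩ := exists_leftMul_of_ne_zero hK h
        rcases hm'.mul_mon (K := K) with e | e <;> rw [e]
        · exact hmon m'
        · exact S.neg_mem (hmon m')
    · by_cases h : mon K m * wordF K (FreeMagma.of x) = 0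
      · rw [h]; exact S.zero_mem
      · obtain ⟨m', hm'⟩ := exists_rightMul_of_ne_zero hK h
        rcases hm'.mon_mul (K := K) with e | e <;> rw [e]
        · exact hmon m'
        · exact S.neg_mem (hmon m')
  | ih2 a b iha ihb =>
    refine mul_mem_span_of_mon fun m => ⟨?_, ?_⟩
    · have h : wordF K (a * m.toMagma * b) ∈ S := by
        rw [wordF_mul, wordF_mul]
        exact (ihb _ (iha _ (hmon m)).1).2
      rw [mon_eq, ← wordF_mul]
      rcases SignEq.right_comm (K := K) a b m.toMagma with e | e <;> rw [e]
      · exact h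
      · exact S.neg_mem h
    · have h : wordF K (a * (m.toMagma * b)) ∈ S := by
        rw [wordF_mul, wordF_mul]
        exact (iha _ (ihb _ (hmon m)).2).1
      rw [mon_eq, ← wordF_mul]
      rcases SignEq.left_comm (K := K) m.toMagma a b with e | e <;> rw [e]
      · exact h
      · exact S.neg_mem h

theorem wordF_mem_span_mon (hK : (2 : K) ≠ 0) (w : FreeMagma (Gen p q)) :
    wordF K w ∈ Submodule.span K (Set.range (mon K (p := p) (q := q))) := by
  induction w using FreeMagma.recOnMul with
  | ih1 x => exact Submodule.subset_span ⟨Mon.gen x, rfl⟩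
  | ih2 a b _ ihb =>
    rw [wordF_mul]
    exact (wordF_mul_mem_span_mon hK a _ ihb).1

theorem span_wordF : Submodule.span K (Set.range (wordF K (p := p) (q := q))) = ⊤ := by
  rw [eq_top_iff]
  rintro f -
  obtain ⟨f, rfl⟩ := Submodule.Quotient.mk_surjective _ f
  change toF K p q f ∈ _
  induction f using MonoidAlgebra.induction_linear with
  | zero => simp
  | add f g hf hg => rw [map_add]; exact Submodule.add_mem _ hf hg
  | single w k =>
    have : (MonoidAlgebra.single w k : FreeNonUnitalNonAssocAlgebra K (Gen p q)) =
        k • word K w := by simp [word]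
    rw [this, map_smul]
    exact Submodule.smul_mem _ _ (Submodule.subset_span ⟨w, rfl⟩)

theorem span_mon (hK : (2 : K) ≠ 0) :
    Submodule.span K (Set.range (mon K (p := p) (q := q))) = ⊤ := by
  rw [eq_top_iff, ← span_wordF, Submodule.span_le]
  rintro _ ⟨w, rfl⟩
  exact wordF_mem_span_mon hK w

end Rewriting

/-! ### A Fock space representation -/

section Fock

variable (K : Type*) [Field K] {ι : Type*} [LinearOrder ι] (odd : ι → ℕ)

/-- The number of odd elements of `m` that precede `i`, if `i` is odd, and `0` otherwise: the
number of signs that arise when `i` is sorted into `m`. Here `odd j` is the parity of `j`. -/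
def crossings (i : ι) (m : Multiset ι) : ℕ :=
  odd i * (m.map fun j => if j < i then odd j else 0).sum

theorem crossings_cons (i j : ι) (m : Multiset ι) :
    crossings odd i (j ::ₘ m) = (if j < i then odd i * odd j else 0) + crossings odd i m := by
  simp only [crossings, Multiset.map_cons, Multiset.sum_cons, mul_add]
  split_ifs <;> simp

/-- The creation operator of `i` on the vector space with basis the multisets: multiplication by
the variable `i` in the free supercommutative algebra, written in its basis of sorted monomials. -/
def creation (i : ι) : Module.End K (Multiset ι →₀ K) :=
  Finsupp.linearCombination K fun m =>
    if odd i = 1 ∧ i ∈ m then 0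
    else (-1 : K) ^ crossings odd i m • Finsupp.single (i ::ₘ m) 1

theorem creation_single (i : ι) (m : Multiset ι) :
    creation K odd i (Finsupp.single m 1) = if odd i = 1 ∧ i ∈ m then 0
      else (-1 : K) ^ crossings odd i m • Finsupp.single (i ::ₘ m) 1 := by
  simp [creation]

/-- Creation operators supercommute. -/
theorem creation_mul_creation (hodd : ∀ i, odd i = 0 ∨ odd i = 1) (i j : ι) :
    creation K odd i * creation K odd j =
      (-1 : K) ^ (odd i * odd j) • (creation K odd j * creation K odd i) := by
  refine Finsupp.lhom_ext' fun m => LinearMap.ext_ring ?_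
  simp only [LinearMap.comp_apply, Finsupp.lsingle_apply, Module.End.mul_apply,
    LinearMap.smul_apply, creation_single]
  rcases eq_or_ne i j with rfl | hij
  · rcases hodd i with h | h
    · simp [h]
    · by_cases hm : i ∈ m <;> simp [-Finsupp.smul_single, h, hm, creation_single]
  have hji := hij.symm
  by_cases h1 : odd i = 1 ∧ i ∈ m <;> by_cases h2 : odd j = 1 ∧ j ∈ m
  · simp [h1, h2]
  · simp [-Finsupp.smul_single, h1, h2, creation_single]
  · simp [-Finsupp.smul_single, h1, h2, creation_single]
  · simp only [h1, h2, if_false, map_smul, creation_single, Multiset.mem_cons, hij, hji, false_or,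
      smul_smul, ← pow_add, crossings_cons, Multiset.cons_swap i j]
    congr 1
    rcases lt_or_gt_of_ne hij with h | h
    · simp only [h, h.not_gt, if_true, if_false, zero_add]
      rw [show odd i * odd j + (crossings odd i m + (odd j * odd i + crossings odd j m)) =
        2 * (odd i * odd j) + (crossings odd j m + crossings odd i m) by ring, pow_add _ (2 * _)]
      simp
    · simp only [h, h.not_gt, if_true, if_false, zero_add]
      congr 1; ring

/-- A product of creation operators in which no odd one is repeated sends the vacuum vector to a
basis vector, up to sign. -/
theorem prod_creation_vacuum (l : List ι) (hl : ∀ i, odd i = 1 → l.count i ≤ 1) :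
    ∃ c : Kˣ, (l.map (creation K odd)).prod (Finsupp.single 0 1) =
      c • Finsupp.single (l : Multiset ι) (1 : K) := by
  induction l with
  | nil => exact ⟨1, by simp⟩
  | cons i l ih =>
    obtain ⟨c, hc⟩ := ih fun j hj => (List.count_le_count_cons).trans (hl j hj)
    have hi : ¬ (odd i = 1 ∧ i ∈ (l : Multiset ι)) := by
      rintro ⟨h, hm⟩
      have h1 := hl i h
      have h2 := List.count_pos_iff.2 (Multiset.mem_coe.1 hm)
      rw [List.count_cons_self] at h1
      omega
    refine ⟨c * (-1) ^ crossings odd i l, ?_⟩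
    rw [List.map_cons, List.prod_cons, Module.End.mul_apply, hc, Units.smul_def, map_smul,
      creation_single, if_neg hi, smul_smul, Units.smul_def]
    simp

end Fock

/-! ### Linear independence of the monomials -/

section Independence

variable (K : Type*) [Field K] {p q : ℕ}

/-- The parity of a generator. -/
def parity (x : Gen p q) : ℕ := Sum.elim (fun _ => 0) (fun _ => 1) (ofLex x)

/-- The parity of a letter of the doubled alphabet, which has a left and a right copy of every
generator. -/
def parity₂ (x : Gen p q ⊕ₗ Gen p q) : ℕ := Sum.elim parity parity (ofLex x)

/-- The left copy of a generator. -/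
def leftCopy (x : Gen p q) : Gen p q ⊕ₗ Gen p q := toLex (Sum.inl x)

/-- The right copy of a generator. -/
def rightCopy (x : Gen p q) : Gen p q ⊕ₗ Gen p q := toLex (Sum.inr x)

theorem leftCopy_injective : Function.Injective (leftCopy (p := p) (q := q)) :=
  fun _ _ h => Sum.inl_injective (toLex.injective h)

theorem rightCopy_injective : Function.Injective (rightCopy (p := p) (q := q)) :=
  fun _ _ h => Sum.inr_injective (toLex.injective h)

theorem leftCopy_ne_rightCopy (x y : Gen p q) : leftCopy x ≠ rightCopy y :=
  fun h => Sum.inl_ne_inr (toLex.injective h)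

theorem parity_eq (x : Gen p q) : parity x = 0 ∨ parity x = 1 := by
  rcases x with x | x
  · exact Or.inl rfl
  · exact Or.inr rfl

theorem parity₂_eq (x : Gen p q ⊕ₗ Gen p q) : parity₂ x = 0 ∨ parity₂ x = 1 := by
  rcases x with x | x
  · exact parity_eq x
  · exact parity_eq x

theorem exists_oddGen_of_parity {x : Gen p q} (h : parity x = 1) : ∃ j, x = oddGen j := by
  rcases x with x | x
  · exact absurd h Nat.zero_ne_one
  · exact ⟨x, rfl⟩

/-- The creation operators on the Fock space of the doubled alphabet. -/
def op (i : Gen p q ⊕ₗ Gen p q) : Module.End K (Multiset (Gen p q ⊕ₗ Gen p q) →₀ K) :=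
  creation K parity₂ i

/-- The operators `(λ(w), ρ(w))` by which a word acts from the left and from the right:
a generator `x` has the left and the right copy of `x`, and
`λ(ab) = ρ(ab) = λ(a)ρ(b)`. -/
def wordOps : FreeMagma (Gen p q) →
    Module.End K (Multiset (Gen p q ⊕ₗ Gen p q) →₀ K) ×
      Module.End K (Multiset (Gen p q ⊕ₗ Gen p q) →₀ K)
  | FreeMagma.of x => (op K (leftCopy x), op K (rightCopy x))
  | FreeMagma.mul a b =>
      ((wordOps a).1 * (wordOps b).2, (wordOps a).1 * (wordOps b).2)

theorem wordOps_of (x : Gen p q) :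
    wordOps K (FreeMagma.of x) = (op K (leftCopy x), op K (rightCopy x)) := rfl

theorem wordOps_mul (a b : FreeMagma (Gen p q)) : wordOps K (a * b) =
    ((wordOps K a).1 * (wordOps K b).2, (wordOps K a).1 * (wordOps K b).2) := rfl

/-- `SuperComm m A n B`: operators `A` of parity `m` and `B` of parity `n` supercommute. -/
def SuperComm {V : Type*} [AddCommGroup V] [Module K V] (m : ℕ) (A : Module.End K V) (n : ℕ)
    (B : Module.End K V) : Prop :=
  A * B = (-1 : K) ^ (m * n) • (B * A)

variable {K} in
theorem SuperComm.symm {V : Type*} [AddCommGroup V] [Module K V] {m n : ℕ}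
    {A B : Module.End K V} (h : SuperComm K m A n B) : SuperComm K n B m A := by
  unfold SuperComm at h ⊢
  rw [h, smul_smul, ← pow_add, show n * m + m * n = 2 * (m * n) by ring]
  simp

variable {K} in
theorem SuperComm.mul_right {V : Type*} [AddCommGroup V] [Module K V] {m n k : ℕ}
    {A B C : Module.End K V} (h : SuperComm K m A n B) (h' : SuperComm K m A k C) :
    SuperComm K m A (n + k) (B * C) := by
  unfold SuperComm at h h' ⊢
  rw [← mul_assoc, h, smul_mul_assoc, mul_assoc, h', mul_smul_comm, smul_smul, ← pow_add,
    ← mul_add, mul_assoc]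

theorem superComm_wordOps_of {m : ℕ} {A : Module.End K (Multiset (Gen p q ⊕ₗ Gen p q) →₀ K)}
    (h : ∀ i, SuperComm K m A (parity₂ i) (op K i)) (w : FreeMagma (Gen p q)) :
    SuperComm K m A (oddDeg w) (wordOps K w).1 ∧ SuperComm K m A (oddDeg w) (wordOps K w).2 := by
  induction w using FreeMagma.recOnMul with
  | ih1 x => exact ⟨h (leftCopy x), h (rightCopy x)⟩
  | ih2 a b iha ihb => exact ⟨iha.1.mul_right ihb.2, iha.1.mul_right ihb.2⟩

theorem superComm_wordOps (a b : FreeMagma (Gen p q)) :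
    SuperComm K (oddDeg a) (wordOps K a).1 (oddDeg b) (wordOps K b).1 ∧
      SuperComm K (oddDeg a) (wordOps K a).2 (oddDeg b) (wordOps K b).2 := by
  have h : ∀ (w : FreeMagma (Gen p q)) (i : Gen p q ⊕ₗ Gen p q),
      SuperComm K (parity₂ i) (op K i) (oddDeg w) (wordOps K w).1 ∧
        SuperComm K (parity₂ i) (op K i) (oddDeg w) (wordOps K w).2 := fun w i =>
    superComm_wordOps_of K (fun j => creation_mul_creation K parity₂ parity₂_eq i j) w
  exact ⟨(superComm_wordOps_of K (fun i => (h a i).1.symm) b).1,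
    (superComm_wordOps_of K (fun i => (h a i).2.symm) b).2⟩

/-- The linear extension of `wordOps` to the free nonassociative algebra. -/
def freeOps : FreeNonUnitalNonAssocAlgebra K (Gen p q) →ₗ[K]
    Module.End K (Multiset (Gen p q ⊕ₗ Gen p q) →₀ K) ×
      Module.End K (Multiset (Gen p q ⊕ₗ Gen p q) →₀ K) :=
  Finsupp.linearCombination K (wordOps K) ∘ₗ (MonoidAlgebra.coeffLinearEquiv K).toLinearMap

theorem freeOps_single (w : FreeMagma (Gen p q)) (k : K) :
    freeOps K (MonoidAlgebra.single w k) = k • wordOps K w := by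
  simp [freeOps, MonoidAlgebra.coeffLinearEquiv]

theorem freeOps_word (w : FreeMagma (Gen p q)) : freeOps K (word K w) = wordOps K w := by
  simp [word, freeOps_single]

theorem freeOps_mul (f g : FreeNonUnitalNonAssocAlgebra K (Gen p q)) : freeOps K (f * g) =
    ((freeOps K f).1 * (freeOps K g).2, (freeOps K f).1 * (freeOps K g).2) := by
  induction f using MonoidAlgebra.induction_linear with
  | zero => simp [Prod.zero_eq_mk]
  | add f f' hf hf' => simp [add_mul, hf, hf']
  | single w k =>
    induction g using MonoidAlgebra.induction_linear with
    | zero => simp [Prod.zero_eq_mk]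
    | add f f' hf hf' => simp [mul_add, hf, hf']
    | single w' k' =>
      simp [MonoidAlgebra.single_mul_single, freeOps_single, wordOps_mul, smul_smul, mul_comm]

theorem relIdeal_le_ker_freeOps : relIdeal K p q ≤ LinearMap.ker (freeOps K) := by
  refine sInf_le ⟨fun a x hx => ?_, ?_⟩
  · rw [LinearMap.mem_ker] at hx
    simp [LinearMap.mem_ker, freeOps_mul, hx]
  · rintro _ ⟨a, b, c, rfl | rfl⟩
    · have h := (superComm_wordOps K a b).1
      unfold SuperComm at h
      simp [freeOps_word, wordOps_mul, ← mul_assoc, h]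
    · have h := (superComm_wordOps K b c).2
      unfold SuperComm at h
      simp [freeOps_word, wordOps_mul, mul_assoc, h]

/-- The effect on the vacuum vector of the left operators of the elements of the free
bicommutative superalgebra. -/
def vacuumF : F K p q →ₗ[K] Multiset (Gen p q ⊕ₗ Gen p q) →₀ K :=
  (relIdeal K p q).liftQ
    (LinearMap.applyₗ (Finsupp.single 0 1) ∘ₗ LinearMap.fst K _ _ ∘ₗ freeOps K)
    ((relIdeal_le_ker_freeOps K).trans fun f hf => by
      rw [LinearMap.mem_ker] at hf ⊢
      rw [LinearMap.comp_apply, LinearMap.comp_apply, hf, map_zero, map_zero])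

theorem vacuumF_wordF (w : FreeMagma (Gen p q)) :
    vacuumF K (wordF K w) = (wordOps K w).1 (Finsupp.single 0 1) := by
  rw [← freeOps_word]
  rfl

theorem wordOps_lmul (as : List (Gen p q)) (t : FreeMagma (Gen p q)) :
    (wordOps K (lmul as t)).2 = ((as.map leftCopy).map (op K)).prod * (wordOps K t).2 := by
  induction as with
  | nil => simp [lmul]
  | cons x as ih => simp [lmul_cons, wordOps_mul, wordOps_of, ih, mul_assoc]

theorem wordOps_rmul (bs : List (Gen p q)) (t : FreeMagma (Gen p q)) :
    (wordOps K (rmul t bs)).1 = (wordOps K t).1 * ((bs.map rightCopy).map (op K)).prod := by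
  induction bs generalizing t with
  | nil => simp [rmul]
  | cons x as ih => simp [rmul_cons, wordOps_mul, wordOps_of, ih, mul_assoc]

theorem wordOps_mul_fst_eq_snd (s t : FreeMagma (Gen p q)) :
    (wordOps K (s * t)).1 = (wordOps K (s * t)).2 := rfl

theorem wordOps_bracket (as bs : List (Gen p q)) (a : Gen p q) (hne : bs ≠ []) :
    (wordOps K (bracket as a bs)).1 =
      (((as ++ [a]).map leftCopy ++ bs.map rightCopy).map (op K)).prod := by
  obtain ⟨b, bs, rfl⟩ := List.exists_cons_of_ne_nil hne
  obtain ⟨s, t, h⟩ := exists_rmul_mul bs (FreeMagma.of a) (FreeMagma.of b)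
  obtain ⟨s', t', h'⟩ := exists_lmul_mul as s t
  rw [bracket_eq, rmul_cons, h, h', wordOps_mul_fst_eq_snd, ← h', wordOps_lmul,
    ← wordOps_mul_fst_eq_snd, ← h, ← rmul_cons, wordOps_rmul, wordOps_of]
  simp

/-- The multiset of letters of a monomial in the doubled alphabet. -/
def Mon.letters : Mon p q → Multiset (Gen p q ⊕ₗ Gen p q)
  | .gen x => {leftCopy x}
  | .tensor u v => u.1.map leftCopy + v.1.map rightCopy

theorem count_leftCopy (u v : Multiset (Gen p q)) (x : Gen p q) :
    (u.map leftCopy + v.map rightCopy).count (leftCopy x) = u.count x := by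
  rw [Multiset.count_add, Multiset.count_map_eq_count' _ _ leftCopy_injective,
    Multiset.count_eq_zero_of_notMem (s := v.map rightCopy), add_zero]
  intro h
  obtain ⟨y, -, hy⟩ := Multiset.mem_map.1 h
  exact leftCopy_ne_rightCopy x y hy.symm

theorem count_rightCopy (u v : Multiset (Gen p q)) (x : Gen p q) :
    (u.map leftCopy + v.map rightCopy).count (rightCopy x) = v.count x := by
  rw [Multiset.count_add, Multiset.count_map_eq_count' _ _ rightCopy_injective,
    Multiset.count_eq_zero_of_notMem (s := u.map leftCopy), zero_add]
  intro h
  obtain ⟨y, -, hy⟩ := Multiset.mem_map.1 h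
  exact leftCopy_ne_rightCopy y x hy

theorem Mon.gen_letters_ne (x : Gen p q) (u v : SMon p q) :
    (Mon.gen x).letters ≠ (Mon.tensor u v).letters := by
  intro h
  obtain ⟨y, hy⟩ := Multiset.exists_mem_of_ne_zero v.2.1
  have hy' : rightCopy y ∈ (Mon.gen x).letters :=
    h ▸ Multiset.mem_add.2 (Or.inr (Multiset.mem_map_of_mem _ hy))
  exact leftCopy_ne_rightCopy x y (Multiset.mem_singleton.1 hy').symm

theorem Mon.letters_injective : Function.Injective (Mon.letters (p := p) (q := q)) := by
  intro m m' h
  cases m with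
  | gen x =>
    cases m' with
    | gen y => exact congrArg _ (leftCopy_injective (Multiset.singleton_inj.1 h))
    | tensor u v => exact (Mon.gen_letters_ne x u v h).elim
  | tensor u v =>
    cases m' with
    | gen y => exact (Mon.gen_letters_ne y u v h.symm).elim
    | tensor u' v' =>
      have hu : u = u' := Subtype.ext <| Multiset.ext' fun x => by
        rw [← count_leftCopy u.1 v.1, ← count_leftCopy u'.1 v'.1]; exact congrArg _ h
      have hv : v = v' := Subtype.ext <| Multiset.ext' fun x => by
        rw [← count_rightCopy u.1 v.1, ← count_rightCopy u'.1 v'.1]; exact congrArg _ h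
      rw [hu, hv]

theorem Mon.count_letters_le (m : Mon p q) (i : Gen p q ⊕ₗ Gen p q) (hi : parity₂ i = 1) :
    m.letters.count i ≤ 1 := by
  cases m with
  | gen x => exact Multiset.nodup_iff_count_le_one.1 (Multiset.nodup_singleton _) i
  | tensor u v =>
    rcases i with x | x
    · obtain ⟨j, rfl⟩ := exists_oddGen_of_parity (x := x) hi
      exact (count_leftCopy u.1 v.1 _).trans_le (u.2.2 j)
    · obtain ⟨j, rfl⟩ := exists_oddGen_of_parity (x := x) hi
      exact (count_rightCopy u.1 v.1 _).trans_le (v.2.2 j)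

theorem exists_wordOps_toMagma (m : Mon p q) : ∃ l : List (Gen p q ⊕ₗ Gen p q),
    (l : Multiset (Gen p q ⊕ₗ Gen p q)) = m.letters ∧
      (wordOps K m.toMagma).1 = (l.map (op K)).prod := by
  cases m with
  | gen x => exact ⟨[leftCopy x], rfl, by simp [Mon.toMagma, wordOps_of]⟩
  | tensor u v =>
    obtain ⟨as, a, bs, hne, ha, hb, h⟩ := exists_toMagma_tensor u v
    refine ⟨_, ?_, h ▸ wordOps_bracket K as bs a hne⟩
    rw [← Multiset.coe_add, ← Multiset.map_coe, ← Multiset.map_coe, ha, hb]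
    rfl

theorem vacuumF_mon (m : Mon p q) : ∃ c : Kˣ,
    vacuumF K (mon K m) = c • Finsupp.single m.letters (1 : K) := by
  obtain ⟨l, hl, h⟩ := exists_wordOps_toMagma K m
  rw [mon_eq, vacuumF_wordF, h, ← hl]
  refine prod_creation_vacuum K parity₂ l fun i hi => ?_
  have := m.count_letters_le i hi
  rwa [← hl, Multiset.coe_count] at this

/-- The monomials are linearly independent, since they send the vacuum vector to distinct basis
vectors, up to sign. -/
theorem linearIndependent_mon : LinearIndependent K (mon K (p := p) (q := q)) := by
  choose c hc using vacuumF_mon K (p := p) (q := q)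
  refine LinearIndependent.of_comp (vacuumF K) ?_
  have h := ((Finsupp.basisSingleOne (R := K)).linearIndependent.comp _
    (Mon.letters_injective (p := p) (q := q))).units_smul c
  convert h using 1
  ext1 m
  simpa using hc m

end Independence

/-- The monomials form a basis of the free bicommutative superalgebra. -/
def monBasis {K : Type*} [Field K] (hK : (2 : K) ≠ 0) (p q : ℕ) :
    Module.Basis (Mon p q) K (F K p q) :=
  Module.Basis.mk (linearIndependent_mon K) (span_mon hK).ge

theorem monBasis_apply {K : Type*} [Field K] (hK : (2 : K) ≠ 0) {p q : ℕ} (m : Mon p q) :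
    monBasis hK p q m = mon K m :=
  Module.Basis.mk_apply _ _ _

/-! ### Dickson's lemma for the monomials -/

section Dickson

variable {p q : ℕ}

theorem divides_tensor_left {u u' : SMon p q} (h : u.1 ≤ u'.1) (v : SMon p q) :
    Divides (Mon.tensor u v) (Mon.tensor u' v) := by
  obtain ⟨s, hs⟩ := Multiset.le_iff_exists_add.1 h
  induction s using Multiset.induction generalizing u' with
  | empty =>
    obtain rfl : u' = u := Subtype.ext (by rw [hs, add_zero])
    exact Relation.ReflTransGen.refl
  | cons x s ih =>
    have hx : u'.1 = x ::ₘ (u.1 + s) := by rw [hs, Multiset.add_cons]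
    let u'' : SMon p q := ⟨u.1 + s, fun h0 => u.2.1 (add_eq_zero.1 h0).1, fun j =>
      (Multiset.count_le_of_le _ (hx ▸ Multiset.le_cons_self _ _)).trans (u'.2.2 j)⟩
    exact (ih (u' := u'') (Multiset.le_add_right _ _) rfl).tail ⟨x, Or.inl (.tensor u'' u' v hx)⟩

theorem divides_tensor_right (u : SMon p q) {v v' : SMon p q} (h : v.1 ≤ v'.1) :
    Divides (Mon.tensor u v) (Mon.tensor u v') := by
  obtain ⟨s, hs⟩ := Multiset.le_iff_exists_add.1 h
  induction s using Multiset.induction generalizing v' with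
  | empty =>
    obtain rfl : v' = v := Subtype.ext (by rw [hs, add_zero])
    exact Relation.ReflTransGen.refl
  | cons x s ih =>
    have hx : v'.1 = x ::ₘ (v.1 + s) := by rw [hs, Multiset.add_cons]
    let v'' : SMon p q := ⟨v.1 + s, fun h0 => v.2.1 (add_eq_zero.1 h0).1, fun j =>
      (Multiset.count_le_of_le _ (hx ▸ Multiset.le_cons_self _ _)).trans (v'.2.2 j)⟩
    exact (ih (v' := v'') (Multiset.le_add_right _ _) rfl).tail ⟨x, Or.inr (.tensor u v'' v' hx)⟩

theorem wellQuasiOrdered_divides : WellQuasiOrdered (Divides (p := p) (q := q)) := by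
  -- Compare the exponents of both tensor factors, and tag the finitely many generators.
  let code : Mon p q → ((Gen p q → ℕ) × (Gen p q → ℕ)) × Option (Gen p q)
    | .gen x => ((0, 0), some x)
    | .tensor u v => ((fun x => u.1.count x, fun x => v.1.count x), none)
  intro f
  have hfin : Finite (Gen p q) := inferInstanceAs (Finite (Fin p ⊕ Fin q))
  obtain ⟨i, j, hij, h, ht⟩ := (wellQuasiOrdered_le (α := (Gen p q → ℕ) × (Gen p q → ℕ))).prod
    (Finite.wellQuasiOrdered (α := Option (Gen p q)) (· = ·)) (code ∘ f)
  refine ⟨i, j, hij, ?_⟩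
  revert h ht
  change (code (f i)).1 ≤ (code (f j)).1 → (code (f i)).2 = (code (f j)).2 → _
  rcases f i with x | ⟨u, v⟩ <;> rcases f j with y | ⟨u', v'⟩ <;> intro h ht
  · obtain rfl : x = y := Option.some_injective _ ht
    exact Relation.ReflTransGen.refl
  · exact (Option.some_ne_none _ ht).elim
  · exact (Option.some_ne_none _ ht.symm).elim
  · exact (divides_tensor_left (Multiset.le_iff_count.2 h.1) v).trans
      (divides_tensor_right u' (Multiset.le_iff_count.2 h.2))

theorem exists_finset_divides (S : Set (Mon p q)) :
    ∃ T : Finset (Mon p q), ↑T ⊆ S ∧ ∀ w ∈ S, ∃ t ∈ T, Divides t w := by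
  by_contra! H
  obtain ⟨f, -, hf⟩ := exists_seq_of_forall_finset_exists (· ∈ S) (fun m w => ¬ Divides m w)
    fun T hT => H T hT
  obtain ⟨i, j, hij, h⟩ := wellQuasiOrdered_divides f
  exact hf i j hij h

end Dickson

/-! ### Leading monomials -/

section Lead

variable {K : Type*} [Field K] (hK : (2 : K) ≠ 0) {p q : ℕ} {r : Mon p q → Mon p q → Prop}

theorem isLead_iff {f : F K p q} {m : Mon p q} : IsLead r f m ↔
    (monBasis hK p q).repr f m ≠ 0 ∧ ∀ w, (monBasis hK p q).repr f w ≠ 0 → w ≠ m → r w m := by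
  have hb : mon K (p := p) (q := q) = monBasis hK p q := funext fun m => (monBasis_apply hK m).symm
  rw [IsLead, hb]
  constructor
  · rintro ⟨c, rfl, h1, h2⟩
    rw [Module.Basis.repr_linearCombination]
    exact ⟨h1, fun w hw => h2 w (Finsupp.mem_support_iff.2 hw)⟩
  · rintro ⟨h1, h2⟩
    exact ⟨_, (monBasis hK p q).linearCombination_repr f, h1,
      fun w hw => h2 w (Finsupp.mem_support_iff.1 hw)⟩

include hK

theorem isLead_mon (m : Mon p q) : IsLead r (mon K m) m := by
  rw [isLead_iff hK, ← monBasis_apply hK, Module.Basis.repr_self]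
  refine ⟨by simp, fun w hw hne => ?_⟩
  exact (hw (Finsupp.single_eq_of_ne hne)).elim

theorem IsLead.unique (hr : IsWellOrder (Mon p q) r) {f : F K p q} {m m' : Mon p q}
    (h : IsLead r f m) (h' : IsLead r f m') : m = m' := by
  rw [isLead_iff hK] at h h'
  by_contra hne
  exact asymm_of r (h.2 m' h'.1 (Ne.symm hne)) (h'.2 m h.1 hne)

theorem exists_isLead (hr : IsWellOrder (Mon p q) r) {f : F K p q} (hf : f ≠ 0) :
    ∃ m, IsLead r f m := by
  let _ := IsWellOrder.linearOrder r
  have hne : ((monBasis hK p q).repr f).support.Nonempty := by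
    rw [Finsupp.support_nonempty_iff]
    simpa using hf
  obtain ⟨m, hm, hmax⟩ := Finset.exists_max_image _ id hne
  refine ⟨m, (isLead_iff hK).2 ⟨Finsupp.mem_support_iff.1 hm, fun w hw hwm => ?_⟩⟩
  exact lt_of_le_of_ne (hmax w (Finsupp.mem_support_iff.2 hw)) hwm

/-- The leading term of an element can be cancelled by a multiple of any element with the same
leading monomial. -/
theorem IsLead.exists_cancel {f g : F K p q} {m : Mon p q} (hf : IsLead r f m)
    (hg : IsLead r g m) : ∃ k : K, ∀ w, (monBasis hK p q).repr (f - k • g) w ≠ 0 → r w m := by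
  rw [isLead_iff hK] at hf hg
  refine ⟨(monBasis hK p q).repr f m / (monBasis hK p q).repr g m, fun w hw => ?_⟩
  rw [map_sub, map_smul, Finsupp.sub_apply, Finsupp.smul_apply, smul_eq_mul] at hw
  by_cases hwm : w = m
  · subst hwm
    rw [div_mul_cancel₀ _ hg.1, sub_self] at hw
    exact (hw rfl).elim
  · by_cases h1 : (monBasis hK p q).repr f w = 0
    · refine hg.2 w (fun h2 => hw ?_) hwm
      rw [h1, h2, mul_zero, sub_zero]
    · exact hf.2 w h1 hwm

/-- A linear map that acts on the monomials, up to sign, by a partial map `R` that preserves the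
ordering, commutes with taking leading monomials as far as `R` is defined. -/
theorem IsLead.map (hr : IsWellOrder (Mon p q) r) (T : F K p q →ₗ[K] F K p q)
    {R : Mon p q → Mon p q → Prop}
    (hT : ∀ m m', R m m' → T (mon K m) = mon K m' ∨ T (mon K m) = -mon K m')
    (hT' : ∀ m, T (mon K m) ≠ 0 → ∃ m', R m m')
    (hR : ∀ u v u' v', r u v → R u u' → R v v' → r u' v')
    {f : F K p q} {m m' : Mon p q} (hf : IsLead r f m) (hm : R m m') : IsLead r (T f) m' := by
  rw [isLead_iff hK] at hf ⊢
  set b := monBasis hK p q with hb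
  -- `T` sends `w` to a multiple of the monomial `R`-related to `w`.
  have hrepr : ∀ w w', R w w' → b.repr (T (mon K w)) w' ≠ 0 ∧
      ∀ z, b.repr (T (mon K w)) z ≠ 0 → z = w' := by
    intro w w' hw
    have hz : ∀ z, b.repr (mon K w') z ≠ 0 → z = w' := by
      intro z hz
      by_contra hne
      rw [← monBasis_apply hK, Module.Basis.repr_self] at hz
      exact hz (Finsupp.single_eq_of_ne hne)
    have h1 : b.repr (mon K w') w' ≠ 0 := by
      rw [← monBasis_apply hK, Module.Basis.repr_self]; simp
    rcases hT w w' hw with e | e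
    · rw [e]; exact ⟨h1, hz⟩
    · rw [e, map_neg]
      exact ⟨by simpa using h1, fun z h => hz z (by simpa using h)⟩
  have hdef : ∀ w z, b.repr (T (mon K w)) z ≠ 0 → R w z := by
    intro w z hz
    obtain ⟨w', hw'⟩ := hT' w fun h0 => hz (by rw [h0, map_zero]; rfl)
    rwa [(hrepr w w' hw').2 z hz]
  have hsum : ∀ z, b.repr (T f) z = (b.repr f).sum fun w k => k * b.repr (T (mon K w)) z := by
    intro z
    conv_lhs => rw [← b.linearCombination_repr f]
    simp [Finsupp.linearCombination_apply, Finsupp.sum, map_sum, Finsupp.finsetSum_apply, hb,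
      monBasis_apply]
  constructor
  · rw [hsum, Finsupp.sum, Finset.sum_eq_single m]
    · exact mul_ne_zero hf.1 (hrepr m m' hm).1
    · intro w hw hwm
      by_contra h0
      exact irrefl_of r m' (hR w m m' m' (hf.2 w (Finsupp.mem_support_iff.1 hw) hwm)
        (hdef w m' (right_ne_zero_of_mul h0)) hm)
    · exact fun h => (h (Finsupp.mem_support_iff.2 hf.1)).elim
  · intro z hz hzm
    rw [hsum] at hz
    obtain ⟨w, hw, h0⟩ := Finset.exists_ne_zero_of_sum_ne_zero hz
    have hwz := right_ne_zero_of_mul h0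
    refine hR w m z m' (hf.2 w (Finsupp.mem_support_iff.1 hw) ?_) (hdef w z hwz) hm
    rintro rfl
    exact hzm ((hrepr w m' hm).2 z hwz)

/-- The leading monomials of a two-sided ideal are closed under multiples. -/
theorem IsLead.exists_of_divides (hr : IsCompatibleWellOrder r) {J : Submodule K (F K p q)}
    (hJ : IsTwoSidedIdeal J) {g : F K p q} (hg : g ∈ J) {m w : Mon p q} (h : IsLead r g m)
    (hd : Divides m w) : ∃ f ∈ J, IsLead r f w := by
  induction hd with
  | refl => exact ⟨g, hg, h⟩
  | tail _ hx ih =>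
    obtain ⟨f, hf, hlead⟩ := ih
    obtain ⟨x, hx | hx⟩ := hx
    · refine ⟨wordF K (FreeMagma.of x) * f, (hJ _ f hf).1, ?_⟩
      exact hlead.map hK hr.isWellOrder (LinearMap.mulLeft K (wordF K (FreeMagma.of x)))
          (fun _ _ => LeftMul.mul_mon) (fun _ => exists_leftMul_of_ne_zero hK)
          (fun u v u' v' => hr.left x u v u' v') hx
    · refine ⟨f * wordF K (FreeMagma.of x), (hJ _ f hf).2, ?_⟩
      rw [← LinearMap.mulRight_apply (R := K)]
      exact hlead.map hK hr.isWellOrder (LinearMap.mulRight K (wordF K (FreeMagma.of x)))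
          (fun _ _ h => by rw [LinearMap.mulRight_apply]; exact h.mon_mul)
          (fun _ h => exists_rightMul_of_ne_zero hK
            (by rwa [LinearMap.mulRight_apply] at h))
          (fun u v u' v' => hr.right x u v u' v') hx

/-! ### Gröbner–Shirshov bases -/

theorem exists_finite_isGSBasis (hr : IsCompatibleWellOrder r) (I : Submodule K (F K p q)) :
    ∃ G : Set (F K p q), G.Finite ∧ IsGSBasis r I G := by
  obtain ⟨T, hTS, hT⟩ := exists_finset_divides {w | ∃ f ∈ I, IsLead r f w}
  have hex : ∀ t ∈ T, ∃ f ∈ I, IsLead r f t := fun t ht => hTS ht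
  choose! g hgI hg using hex
  refine ⟨g '' T, T.finite_toSet.image g, ?_, fun f hf hf0 => ?_⟩
  · rintro _ ⟨t, ht, rfl⟩
    exact hgI _ ht
  · obtain ⟨w, hw⟩ := exists_isLead hK hr.isWellOrder hf0
    obtain ⟨t, ht, htw⟩ := hT w ⟨f, hf, hw⟩
    exact ⟨g t, ⟨t, ht, rfl⟩, t, w, hg _ ht, hw, htw⟩

variable {I : Submodule K (F K p q)} {G : Set (F K p q)}

theorem IsGSBasis.idealSpan_eq (hr : IsCompatibleWellOrder r) (hI : IsTwoSidedIdeal I)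
    (hG : IsGSBasis r I G) : idealSpan K G = I := by
  refine le_antisymm (sInf_le ⟨hI, hG.1⟩) ?_
  have hwo := hr.isWellOrder
  have hJI : idealSpan K G ≤ I := sInf_le ⟨hI, hG.1⟩
  have key : ∀ w, ∀ f ∈ I, IsLead r f w → f ∈ idealSpan K G := by
    intro w
    induction w using hwo.toIsWellFounded.wf.induction with
    | _ w ih =>
      intro f hf hw
      have hf0 : f ≠ 0 := by
        rintro rfl
        exact ((isLead_iff hK).1 hw).1 (by simp)
      obtain ⟨g, hg, m, w', hm, hw', hd⟩ := hG.2 f hf hf0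
      obtain rfl := hw.unique hK hwo hw'
      obtain ⟨h, hh, hhw⟩ := hm.exists_of_divides hK hr (isTwoSidedIdeal_idealSpan K G)
        (subset_idealSpan K G hg) hd
      obtain ⟨k, hk⟩ := hw.exists_cancel hK hhw
      have hkh := (idealSpan K G).smul_mem k hh
      by_cases h0 : f - k • h = 0
      · rwa [sub_eq_zero.1 h0]
      · obtain ⟨v, hv⟩ := exists_isLead hK hwo h0
        have := ih v (hk v ((isLead_iff hK).1 hv).1) _ (I.sub_mem hf (hJI hkh)) hv
        rw [← sub_add_cancel f (k • h)]
        exact (idealSpan K G).add_mem this hkh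
  intro f hf
  by_cases h0 : f = 0
  · rw [h0]; exact Submodule.zero_mem _
  · obtain ⟨w, hw⟩ := exists_isLead hK hwo h0
    exact key w f hf hw

theorem IsGSBasis.linearIndependent_normal (hG : IsGSBasis r I G) :
    LinearIndependent K (fun w : Normal r G => I.mkQ (mon K (w : Mon p q))) := by
  have hli : LinearIndependent K (fun w : Normal r G => mon K (w : Mon p q)) :=
    (linearIndependent_mon K).comp _ Subtype.val_injective
  refine hli.map (f := I.mkQ) ?_
  rw [Submodule.ker_mkQ, Submodule.disjoint_def]
  intro f hf hfI
  by_contra hf0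
  obtain ⟨g, hg, m, w, hm, hw, hd⟩ := hG.2 f hfI hf0
  have hs : Set.range (fun w : Normal r G => mon K (w : Mon p q)) =
      monBasis hK p q '' Normal r G := by
    ext x; simp [monBasis_apply]
  rw [hs, Module.Basis.mem_span_image] at hf
  exact hf (Finsupp.mem_support_iff.2 ((isLead_iff hK).1 hw).1) ⟨g, hg, m, hm, hd⟩

theorem IsGSBasis.span_normal (hr : IsCompatibleWellOrder r) (hI : IsTwoSidedIdeal I)
    (hG : IsGSBasis r I G) :
    Submodule.span K (Set.range (fun w : Normal r G => I.mkQ (mon K (w : Mon p q)))) = ⊤ := by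
  set N := Submodule.span K (Set.range (fun w : Normal r G => I.mkQ (mon K (w : Mon p q))))
    with hN
  have key : ∀ w : Mon p q, I.mkQ (mon K w) ∈ N := by
    intro w
    induction w using hr.isWellOrder.toIsWellFounded.wf.induction with
    | _ w ih =>
      by_cases hw : w ∈ Normal r G
      · exact Submodule.subset_span ⟨⟨w, hw⟩, rfl⟩
      · obtain ⟨g, hg, m, hm, hd⟩ := not_not.1 hw
        obtain ⟨f, hf, hfw⟩ := hm.exists_of_divides hK hr hI (hG.1 hg) hd
        obtain ⟨k, hk⟩ := (isLead_mon hK w).exists_cancel hK hfw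
        have e : I.mkQ (mon K w) = I.mkQ (mon K w - k • f) := by
          rw [map_sub, map_smul, (I.mkQ_apply f).trans ((Submodule.Quotient.mk_eq_zero I).2 hf),
            smul_zero, sub_zero]
        rw [e, ← (monBasis hK p q).linearCombination_repr (mon K w - k • f),
          Finsupp.linearCombination_apply, Finsupp.sum, map_sum]
        refine N.sum_mem fun v hv => ?_
        rw [map_smul, monBasis_apply]
        exact N.smul_mem _ (ih v (hk v (Finsupp.mem_support_iff.1 hv)))
  rw [eq_top_iff]
  rintro x -
  obtain ⟨f, rfl⟩ := I.mkQ_surjective x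
  rw [← (monBasis hK p q).linearCombination_repr f, Finsupp.linearCombination_apply, Finsupp.sum,
    map_sum]
  refine N.sum_mem fun v _ => ?_
  rw [map_smul, monBasis_apply]
  exact N.smul_mem _ (key v)

end Lead

end BicommSuper

end

theorem theorem4p9 {K : Type*} [Field K] (hK : ringChar K ≠ 2) (p q : ℕ)
    (r : BicommSuper.Mon p q → BicommSuper.Mon p q → Prop)
    (hr : BicommSuper.IsCompatibleWellOrder r)
    (I : Submodule K (BicommSuper.F K p q)) (hI : BicommSuper.IsTwoSidedIdeal I) :
    (∃ G : Set (BicommSuper.F K p q), G.Finite ∧ BicommSuper.IsGSBasis r I G) ∧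
    ∀ G : Set (BicommSuper.F K p q), BicommSuper.IsGSBasis r I G →
      BicommSuper.idealSpan K G = I ∧
      LinearIndependent K
        (fun w : BicommSuper.Normal r G => I.mkQ (BicommSuper.mon K (w : BicommSuper.Mon p q))) ∧
      Submodule.span K (Set.range
        (fun w : BicommSuper.Normal r G =>
          I.mkQ (BicommSuper.mon K (w : BicommSuper.Mon p q)))) = ⊤ := by
  have h2 : (2 : K) ≠ 0 := Ring.two_ne_zero hK
  exact ⟨BicommSuper.exists_finite_isGSBasis h2 hr I, fun G hG =>
    ⟨hG.idealSpan_eq h2 hr hI, hG.linearIndependent_normal h2, hG.span_normal h2 hr hI⟩⟩
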